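/- For a finite group $G$, say that $G$ has the cut-property if every element of the centre $\mathcal{Z}(\mathcal{U}(\mathbb{Z}[G]))$ of the unit group of the integral group ring $\mathbb{Z}[G]$ is trivial, i.e. of the form $\pm g$ with $g$ in the centre $\mathcal{Z}(G)$ of $G$. For $x\in G$ put $[x,G]:=\{xgx^{-1}g^{-1} \mid g\in G\}$. Let $p$ be a prime. A nontrivial finite $p$-group $G$ of nilpotency class at most $2$ (in particular, any finite $p$-group of class exactly $2$) has the cut-property if and only if one of the following holds: (i) $p=2$ and $x^{4}\in[x,G]$ for every $x\in G$; (ii) $p=3$ and $x^{3}\in[x,G]$ for every $x\in G$. Furthermore, if $H$ and $K$ are finite $p$-groups (for the same prime $p$) of nilpotency class at most $2$ that both have the cut-property, then their direct sum $H\oplus K$ has the cut-property. -/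

import Mathlib

/-- The cut-property: every element of the centre of the unit group of the integral group ring
`ℤ[G]` is a trivial central unit, i.e. equal to `g` or `-g` for some `g` in the centre of `G`. -/
def HasCutProperty (G : Type*) [Group G] : Prop :=
  ∀ u ∈ Subgroup.center (MonoidAlgebra ℤ G)ˣ,
    ∃ g ∈ Subgroup.center G,
      (u : MonoidAlgebra ℤ G) = MonoidAlgebra.of ℤ G g ∨
        (u : MonoidAlgebra ℤ G) = -MonoidAlgebra.of ℤ G g

/-- The set `[x, G] = {x g x⁻¹ g⁻¹ | g ∈ G}`. -/
def commutatorsWith {G : Type*} [Group G] (x : G) : Set G :=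
  {y | ∃ g : G, y = x * g * x⁻¹ * g⁻¹}

/-!
A class function on a group `G` of class at most two is tested against the normalised irreducible
characters of `G`, encoded as functions `L : G → ℂ` satisfying `IsCentralCharacter`. Such an `L` is
multiplicative on a subgroup `S`, vanishes off `S`, and is trivial on all commutators `⁅t, g⁆` with
`g ∈ S`; its linear extension to the group ring is multiplicative on the centre
(`IsCentralCharacter.groupRingEval_mul`). These functions separate class functions, because their
combinations include the indicator of the identity (`apply_one_eq_of_forall_isCentralCharacter`).

Sufficiency. If `x ^ n` is a commutator of `x` for every `x`, where `n` is `3` or `4`, then the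
nonzero values of `L` are `n`-th roots of unity, so `L` maps a central unit `u` to a unit of the
Eisenstein or Gaussian integers, whose absolute value is one. Hence every `L` takes the value one on
`u * star u`, so this element has coefficient one at the identity. That coefficient is the sum of
the squares of the coefficients of `u`, and `u` is trivial
(`hasCutProperty_of_forall_pow_mem_commutatorsWith`).

Necessity. The set of all `⁅x, g⁆` is a central subgroup `C`, and `x` together with the centre
generates an abelian normal subgroup `A`. For `k` prime to the order of `G`, the product of the Bass
units `bassElement` at the conjugates of `x` is a central unit. A linear character `χ` of `A` which
is trivial on `C` takes one value `ζ` at all conjugates of `x`, so it maps this central unit to a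
power of a number whose absolute value is a power of `‖ζ ^ k - 1‖ / ‖ζ - 1‖`. If all central units
are trivial this ratio is one, and `ζ ^ k` is `ζ` or its inverse
(`HasCutProperty.pow_eq_or_pow_succ_eq_one`). Taking `k = 3` for `p = 2` and `k = 2` for odd `p`
gives `x ^ 4 ∈ C` and `x ^ 3 ∈ C` respectively; in the odd case a nontrivial central element then
has order three, so `p = 3`. The resulting criterion is inherited by direct products.
-/

open scoped commutatorElement

/-! ### Groups of class at most two -/

section ClassTwo

variable {G : Type*} [Group G]

theorem commutatorElement_mem_center_of_nilpotencyClass_le_two [Group.IsNilpotent G]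
    (h : Group.nilpotencyClass G ≤ 2) (g t : G) : ⁅g, t⁆ ∈ Subgroup.center G := by
  have htop := Subgroup.upperCentralSeries_eq_top_iff_nilpotencyClass_le.2 h
  have hg : g ∈ Subgroup.upperCentralSeries G 2 := htop ▸ Subgroup.mem_top g
  have := (Subgroup.mem_upperCentralSeries_succ_iff).1 hg t
  rwa [Subgroup.upperCentralSeries_one] at this

theorem commutatorElement_mul_right_of_mem_center (hc : ∀ g t : G, ⁅g, t⁆ ∈ Subgroup.center G)
    (x g h : G) : ⁅x, g * h⁆ = ⁅x, g⁆ * ⁅x, h⁆ := by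
  have := Subgroup.mem_center_iff.1 (hc x h) g
  calc ⁅x, g * h⁆ = ⁅x, g⁆ * (g * ⁅x, h⁆ * g⁻¹) := by simp only [commutatorElement_def]; group
    _ = ⁅x, g⁆ * ⁅x, h⁆ := by rw [this, mul_inv_cancel_right]

/-- In a group of class at most two, commutation with a fixed element is a homomorphism into the
centre. -/
def commutatorHom (hc : ∀ g t : G, ⁅g, t⁆ ∈ Subgroup.center G) (x : G) :
    G →* Subgroup.center G where
  toFun g := ⟨⁅x, g⁆, hc x g⟩
  map_one' := by ext; simp
  map_mul' g h := by ext; exact commutatorElement_mul_right_of_mem_center hc x g h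

/-- In a group of class at most two the set `[x, G]` is a subgroup. -/
theorem exists_subgroup_coe_eq_commutatorsWith (hc : ∀ g t : G, ⁅g, t⁆ ∈ Subgroup.center G)
    (x : G) : ∃ C : Subgroup G, (C : Set G) = commutatorsWith x := by
  refine ⟨(commutatorHom hc x).range.map (Subgroup.center G).subtype, ?_⟩
  ext y
  simp only [Subgroup.coe_map, Set.mem_image, SetLike.mem_coe, MonoidHom.mem_range,
    Subgroup.coe_subtype, commutatorsWith, Set.mem_ofPred_eq]
  constructor
  · rintro ⟨_, ⟨g, rfl⟩, rfl⟩
    exact ⟨g, rfl⟩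
  · rintro ⟨g, rfl⟩
    exact ⟨_, ⟨g, rfl⟩, rfl⟩

end ClassTwo

/-! ### Characters of finite abelian groups -/

section Characters

theorem MonoidHom.exists_comp_eq_of_ker_le {Z A : Type*} [Group Z] [CommGroup A] [Finite A]
    (f : Z →* A) (μ : Z →* ℂˣ) (h : f.ker ≤ μ.ker) : ∃ ν : A →* ℂˣ, ν.comp f = μ := by
  obtain ⟨ν, hν⟩ := MonoidHom.domRestrict_surjective ℂ f.range
    (f.rangeRestrict.liftOfSurjective f.rangeRestrict_surjective
      ⟨μ, by rwa [MonoidHom.ker_rangeRestrict]⟩)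
  refine ⟨ν, ?_⟩
  ext z
  have h1 := DFunLike.congr_fun hν (f.rangeRestrict z)
  have h2 := f.rangeRestrict.liftOfRightInverse_comp_apply _
    (Function.rightInverse_surjInv f.rangeRestrict_surjective)
    ⟨μ, by rwa [MonoidHom.ker_rangeRestrict]⟩ z
  exact congrArg Units.val (h1.trans h2)

theorem exists_character_apply_ne_one {A : Type*} [CommGroup A] [Finite A] (C : Subgroup A)
    {y : A} (hy : y ∉ C) : ∃ ν : A →* ℂˣ, (∀ c ∈ C, ν c = 1) ∧ ν y ≠ 1 := by
  by_contra! h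
  exact hy ((CommGroup.forall_monoidHom_apply_eq_one_iff ℂ C y).1 h)

theorem sum_characters_apply_eq_zero {A : Type*} [CommGroup A] [Finite A] [Fintype (A →* ℂˣ)]
    {a : A} (ha : a ≠ 1) : ∑ χ : A →* ℂˣ, (χ a : ℂ) = 0 := by
  obtain ⟨ψ, hψ⟩ := CommGroup.exists_apply_ne_one_of_hasEnoughRootsOfUnity A ℂ ha
  have h : ∑ χ : A →* ℂˣ, (χ a : ℂ) = ψ a * ∑ χ : A →* ℂˣ, (χ a : ℂ) := by
    rw [Finset.mul_sum, ← Equiv.sum_comp (Equiv.mulLeft ψ)]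
    simp
  have hψ' : (ψ a : ℂ) - 1 ≠ 0 := fun h0 ↦ hψ (Units.ext (sub_eq_zero.1 h0))
  have : ((ψ a : ℂ) - 1) * ∑ χ : A →* ℂˣ, (χ a : ℂ) = 0 := by linear_combination -h
  exact (mul_eq_zero.1 this).resolve_left hψ'

end Characters

/-! ### Central characters -/

section CentralCharacters

variable {G : Type*} [Group G]

/-- A function `L : G → ℂ` is a central character function if its support is a subgroup `S`
containing the centre, `L` is multiplicative on `S`, and an element `g` lies in `S` exactly when `L`
is trivial on all commutators `⁅t, g⁆`. For a group of class at most two these are the functions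
`χ / χ(1)` with `χ` an irreducible character. -/
structure IsCentralCharacter (L : G → ℂ) : Prop where
  one : L 1 = 1
  mul_right : ∀ g h, L h ≠ 0 → L (g * h) = L g * L h
  ne_zero_of_mem_center : ∀ z ∈ Subgroup.center G, L z ≠ 0
  commutator_eq_one : ∀ g t : G, L g ≠ 0 → L ⁅t, g⁆ = 1
  exists_commutator_ne_one : ∀ g : G, L g = 0 → ∃ t : G, L ⁅t, g⁆ ≠ 1

/-- A character `μ` of the centre extends to every subgroup `S` containing the centre such that
`μ` is trivial on the commutators of `S`. -/
theorem exists_character_extending_center [Finite G] (hc : ∀ g t : G, ⁅g, t⁆ ∈ Subgroup.center G)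
    (μ : Subgroup.center G →* ℂˣ) (S : Subgroup G) (hZS : Subgroup.center G ≤ S)
    (hS : ∀ g ∈ S, ∀ t, μ ⟨⁅t, g⁆, hc t g⟩ = 1) :
    ∃ Λ : S →* ℂˣ, ∀ z : Subgroup.center G, Λ (Subgroup.inclusion hZS z) = μ z := by
  let f : Subgroup.center G →* Abelianization S :=
    Abelianization.of.comp (Subgroup.inclusion hZS)
  have hcomm : commutator S ≤ (μ.ker.map (Subgroup.center G).subtype).subgroupOf S := by
    rw [commutator_def, Subgroup.commutator_le]
    rintro a - b -
    rw [Subgroup.mem_subgroupOf]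
    exact ⟨⟨⁅(a : G), b⁆, hc a b⟩, hS b b.2 a, rfl⟩
  have hker : f.ker ≤ μ.ker := by
    intro z hz
    have h1 : Subgroup.inclusion hZS z ∈ commutator S := by
      rw [MonoidHom.mem_ker] at hz
      exact (QuotientGroup.eq_one_iff _).1 hz
    obtain ⟨z', hz', h⟩ := Subgroup.mem_map.1 (Subgroup.mem_subgroupOf.1 (hcomm h1))
    have : z' = z := Subtype.ext h
    rwa [this] at hz'
  obtain ⟨ν, hν⟩ := MonoidHom.exists_comp_eq_of_ker_le f μ hker
  exact ⟨ν.comp Abelianization.of, fun z ↦ DFunLike.congr_fun hν z⟩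

/-- Every character `μ` of the centre extends to a central character function, supported on the
subgroup of all `g` with `μ ⁅t, g⁆ = 1` for every `t`. -/
theorem exists_isCentralCharacter [Finite G] (hc : ∀ g t : G, ⁅g, t⁆ ∈ Subgroup.center G)
    (μ : Subgroup.center G →* ℂˣ) :
    ∃ L : G → ℂ, IsCentralCharacter L ∧ ∀ z : Subgroup.center G, L z = μ z := by
  classical
  obtain ⟨S, hS⟩ : ∃ S : Subgroup G, ∀ g, g ∈ S ↔ ∀ t, μ ⟨⁅t, g⁆, hc t g⟩ = 1 := by
    refine ⟨⨅ t, (μ.comp (commutatorHom hc t)).ker, fun g ↦ ?_⟩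
    rw [Subgroup.mem_iInf]
    exact Iff.rfl
  have hZS : Subgroup.center G ≤ S := by
    intro z hz
    refine (hS z).2 fun t ↦ ?_
    have : (⟨⁅t, z⁆, hc t z⟩ : Subgroup.center G) = 1 :=
      Subtype.ext (commutatorElement_eq_one_iff_mul_comm.2 (Subgroup.mem_center_iff.1 hz t))
    rw [this, map_one]
  obtain ⟨Λ, hΛ⟩ := exists_character_extending_center hc μ S hZS fun g hg ↦ (hS g).1 hg
  obtain ⟨L, hL, hL0⟩ : ∃ L : G → ℂ, (∀ s : S, L s = Λ s) ∧ ∀ g ∉ S, L g = 0 :=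
    ⟨fun g ↦ if h : g ∈ S then Λ ⟨g, h⟩ else 0, fun s ↦ dif_pos s.2, fun g hg ↦ dif_neg hg⟩
  have hLS {g : G} : L g ≠ 0 ↔ g ∈ S :=
    ⟨fun h ↦ by_contra fun h' ↦ h (hL0 g h'),
      fun h ↦ by rw [hL ⟨g, h⟩]; exact Units.ne_zero _⟩
  have hLμ (z : Subgroup.center G) : L z = μ z := by
    rw [← hΛ, ← hL, Subgroup.coe_inclusion]
  refine ⟨L, ⟨?_, ?_, ?_, ?_, ?_⟩, hLμ⟩
  · simpa using hLμ 1
  · intro g h hh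
    rw [hLS] at hh
    by_cases hg : g ∈ S
    · rw [hL ⟨g, hg⟩, hL ⟨h, hh⟩, ← Units.val_mul, ← map_mul, ← hL]
      rfl
    · rw [hL0 g hg, hL0 _ (fun h' ↦ hg ((Subgroup.mul_mem_cancel_right S hh).1 h')), zero_mul]
  · exact fun z hz ↦ hLS.2 (hZS hz)
  · intro g t hg
    rw [hLμ ⟨⁅t, g⁆, hc t g⟩, (hS g).1 (hLS.1 hg) t, Units.val_one]
  · intro g hg
    have hg' : g ∉ S := fun h ↦ hLS.2 h hg
    rw [hS] at hg'
    push Not at hg'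
    obtain ⟨t, ht⟩ := hg'
    refine ⟨t, fun h ↦ ht (Units.ext ?_)⟩
    rw [← hLμ, Units.val_one, ← h]

namespace IsCentralCharacter

variable {L : G → ℂ}

theorem mul_character (hL : IsCentralCharacter L) (χ : Abelianization G →* ℂˣ) :
    IsCentralCharacter fun g ↦ L g * χ (Abelianization.of g) := by
  have hχ (t g : G) : (χ (Abelianization.of ⁅t, g⁆) : ℂ) = 1 := by
    rw [map_commutatorElement, commutatorElement_eq_one_iff_mul_comm.2 (mul_comm _ _), map_one,
      Units.val_one]
  have h0 (g : G) : L g * (χ (Abelianization.of g) : ℂ) = 0 ↔ L g = 0 := by simp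
  refine ⟨by simp [hL.one], ?_, ?_, ?_, ?_⟩
  · intro g h hh
    rw [hL.mul_right g h (fun h' ↦ hh ((h0 h).2 h')), map_mul, map_mul, Units.val_mul]
    ring
  · exact fun z hz h ↦ hL.ne_zero_of_mem_center z hz ((h0 z).1 h)
  · intro g t hg
    rw [hχ, mul_one, hL.commutator_eq_one g t (fun h' ↦ hg ((h0 g).2 h'))]
  · intro g hg
    obtain ⟨t, ht⟩ := hL.exists_commutator_ne_one g ((h0 g).1 hg)
    exact ⟨t, by rwa [hχ, mul_one]⟩

theorem apply_mul_inv (hL : IsCentralCharacter L) {g : G} (hg : L g ≠ 0) : L g⁻¹ * L g = 1 := by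
  rw [← hL.mul_right _ _ hg, inv_mul_cancel, hL.one]

theorem inv_ne_zero (hL : IsCentralCharacter L) {g : G} (hg : L g ≠ 0) : L g⁻¹ ≠ 0 :=
  left_ne_zero_of_mul_eq_one (hL.apply_mul_inv hg)

theorem apply_pow (hL : IsCentralCharacter L) {g : G} (hg : L g ≠ 0) (n : ℕ) :
    L (g ^ n) = L g ^ n := by
  induction n with
  | zero => simp [hL.one]
  | succ n ih => rw [pow_succ, hL.mul_right _ _ hg, ih, pow_succ]

theorem pow_eq_one (hL : IsCentralCharacter L) {g : G} {n : ℕ} (hn : g ^ n ∈ commutatorsWith g)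
    (hg : L g ≠ 0) : L g ^ n = 1 := by
  obtain ⟨t, ht⟩ := hn
  have h1 : L ⁅t, g⁆ = 1 := hL.commutator_eq_one g t hg
  have h2 := hL.apply_mul_inv (g := ⁅t, g⁆) (by simp [h1])
  rw [commutatorElement_inv, h1, mul_one] at h2
  rwa [← hL.apply_pow hg, ht]

theorem conj_apply [Finite G] (hL : IsCentralCharacter L) (g : G) :
    (starRingEnd ℂ) (L g) = L g⁻¹ := by
  by_cases hg : L g = 0
  · by_cases hg' : L g⁻¹ = 0
    · simp [hg, hg']
    · exact absurd hg (by simpa using hL.inv_ne_zero hg')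
  · have h1 : L g ^ Nat.card G = 1 := by rw [← hL.apply_pow hg, pow_card_eq_one', hL.one]
    have h2 : ‖L g‖ = 1 := Complex.norm_eq_one_of_pow_eq_one h1 Nat.card_pos.ne'
    have h3 : (starRingEnd ℂ) (L g) * L g = 1 := by
      rw [← Complex.normSq_eq_conj_mul_self, Complex.normSq_eq_norm_sq, h2]
      simp
    exact mul_right_cancel₀ hg (h3.trans (hL.apply_mul_inv hg).symm)

end IsCentralCharacter

/-- The linear extension of a function `F` on `G` to the group ring `ℤ[G]`. -/
noncomputable def groupRingEval [Fintype G] (F : G → ℂ) (z : MonoidAlgebra ℤ G) : ℂ :=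
  ∑ g, (z.coeff g : ℂ) * F g

section Eval

variable [Fintype G]

@[simp]
theorem groupRingEval_add (F : G → ℂ) (z w : MonoidAlgebra ℤ G) :
    groupRingEval F (z + w) = groupRingEval F z + groupRingEval F w := by
  simp [groupRingEval, add_mul, Finset.sum_add_distrib]

@[simp]
theorem groupRingEval_zero (F : G → ℂ) : groupRingEval F 0 = 0 := by
  simp [groupRingEval]

omit [Group G] in
theorem groupRingEval_single (F : G → ℂ) (g : G) (a : ℤ) :
    groupRingEval F (MonoidAlgebra.single g a) = a * F g := by
  classical
  simp [groupRingEval, Finsupp.single_apply, ite_mul]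

theorem groupRingEval_one (F : G → ℂ) : groupRingEval F 1 = F 1 := by
  simp [MonoidAlgebra.one_def, groupRingEval_single]

theorem groupRingEval_mul (F : G → ℂ) (z w : MonoidAlgebra ℤ G) :
    groupRingEval F (z * w) = ∑ h, (w.coeff h : ℂ) * groupRingEval (fun g ↦ F (g * h)) z := by
  change _ = groupRingEval (fun h ↦ groupRingEval (fun g ↦ F (g * h)) z) w
  induction w using MonoidAlgebra.induction_linear with
  | zero => simp
  | add w₁ w₂ h₁ h₂ => rw [mul_add, groupRingEval_add, groupRingEval_add, h₁, h₂]
  | single h b =>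
    rw [groupRingEval_single]
    induction z using MonoidAlgebra.induction_linear with
    | zero => simp
    | add z₁ z₂ h₁ h₂ => rw [add_mul, groupRingEval_add, groupRingEval_add, h₁, h₂, mul_add]
    | single g a =>
      rw [MonoidAlgebra.single_mul_single, groupRingEval_single, groupRingEval_single]
      push_cast
      ring

/-- A central character function is an eigenfunction of every central element of the group ring. -/
theorem IsCentralCharacter.groupRingEval_translate (hc : ∀ g t : G, ⁅g, t⁆ ∈ Subgroup.center G)
    {L : G → ℂ} (hL : IsCentralCharacter L) {z : MonoidAlgebra ℤ G}
    (hz : ∀ t g, z.coeff (t * g * t⁻¹) = z.coeff g) (h : G) :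
    groupRingEval (fun g ↦ L (g * h)) z = groupRingEval L z * L h := by
  by_cases hh : L h = 0
  · rw [hh, mul_zero]
    obtain ⟨t, ht⟩ := hL.exists_commutator_ne_one h hh
    -- Conjugating the summation variable by `t` multiplies the sum by `L ⁅t, h⁆⁻¹ ≠ 1`.
    have key (g : G) : L ⁅t, h⁆ * L (t * g * t⁻¹ * h) = L (g * h) := by
      have h1 : t * g * t⁻¹ * h = g * h * ⁅t, g⁆ := by
        rw [Subgroup.mem_center_iff.1 (hc t g) (g * h), commutatorElement_def]
        group
      rw [h1, hL.mul_right _ _ (hL.ne_zero_of_mem_center _ (hc t g))]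
      by_cases hgh : L (g * h) = 0
      · simp [hgh]
      · have h2 := hL.commutator_eq_one _ t hgh
        rw [commutatorElement_mul_right_of_mem_center hc,
          hL.mul_right _ _ (hL.ne_zero_of_mem_center _ (hc t h))] at h2
        linear_combination L (g * h) * h2
    have h3 : L ⁅t, h⁆ * groupRingEval (fun g ↦ L (g * h)) z
        = groupRingEval (fun g ↦ L (g * h)) z := by
      unfold groupRingEval
      conv_lhs => rw [← Equiv.sum_comp (MulAut.conj t).toEquiv]
      rw [Finset.mul_sum]
      refine Finset.sum_congr rfl fun g _ ↦ ?_
      simp only [MulEquiv.toEquiv_eq_coe, EquivLike.coe_coe, MulAut.conj_apply, hz, ← key g]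
      ring
    have h4 : (L ⁅t, h⁆ - 1) * groupRingEval (fun g ↦ L (g * h)) z = 0 := by
      linear_combination h3
    exact (mul_eq_zero.1 h4).resolve_left (sub_ne_zero.2 ht)
  · simp only [groupRingEval, Finset.sum_mul, hL.mul_right _ _ hh, mul_assoc]

/-- Central character functions are multiplicative on the centre of the group ring. -/
theorem IsCentralCharacter.groupRingEval_mul (hc : ∀ g t : G, ⁅g, t⁆ ∈ Subgroup.center G)
    {L : G → ℂ} (hL : IsCentralCharacter L) {z : MonoidAlgebra ℤ G}
    (hz : ∀ t g, z.coeff (t * g * t⁻¹) = z.coeff g) (w : MonoidAlgebra ℤ G) :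
    groupRingEval L (z * w) = groupRingEval L z * groupRingEval L w := by
  rw [_root_.groupRingEval_mul]
  simp only [hL.groupRingEval_translate hc hz]
  rw [groupRingEval, groupRingEval, Finset.mul_sum]
  exact Finset.sum_congr rfl fun h _ ↦ by ring

open scoped IsMulCommutative in
/-- The unit function at `1` is a linear combination of central character functions: averaging over
the twists by linear characters of `G` and then over the characters of the centre leaves only the
value at the identity. -/
theorem apply_one_eq_of_forall_isCentralCharacter (hc : ∀ g t : G, ⁅g, t⁆ ∈ Subgroup.center G)
    (a : G → ℂ) (h : ∀ L : G → ℂ, IsCentralCharacter L → ∑ g, a g * L g = 1) : a 1 = 1 := by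
  classical
  have := Fintype.ofFinite (Abelianization G →* ℂˣ)
  have := Fintype.ofFinite (Subgroup.center G →* ℂˣ)
  have := Fintype.ofFinite (Subgroup.center G)
  choose L hL hLμ using exists_isCentralCharacter hc
  have hsum : ∑ μ, ∑ χ : Abelianization G →* ℂˣ,
      ∑ g, a g * (L μ g * χ (Abelianization.of g)) =
      Fintype.card (Subgroup.center G →* ℂˣ) * Fintype.card (Abelianization G →* ℂˣ) := by
    simp [h _ ((hL _).mul_character _)]
  have hswap : ∑ μ, ∑ χ : Abelianization G →* ℂˣ,
      ∑ g, a g * (L μ g * χ (Abelianization.of g)) =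
      ∑ g, a g * ((∑ μ, L μ g) * ∑ χ : Abelianization G →* ℂˣ, (χ (Abelianization.of g) : ℂ)) := by
    simp only [Finset.sum_mul_sum]
    rw [Finset.sum_congr rfl fun μ _ ↦ Finset.sum_comm, Finset.sum_comm]
    simp only [Finset.mul_sum]
  have hone (g : G) (hg : g ≠ 1) : (∑ μ, L μ g) *
      ∑ χ : Abelianization G →* ℂˣ, (χ (Abelianization.of g) : ℂ) = 0 := by
    by_cases hg' : Abelianization.of g = 1
    · have hgZ : g ∈ Subgroup.center G := by
        have h1 : g ∈ commutator G := (QuotientGroup.eq_one_iff _).1 hg'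
        rw [commutator_def] at h1
        exact (Subgroup.commutator_le.2 fun x _ y _ ↦ hc x y) h1
      have h2 : ∑ μ, L μ g = ∑ μ : Subgroup.center G →* ℂˣ, (μ ⟨g, hgZ⟩ : ℂ) :=
        Finset.sum_congr rfl fun μ _ ↦ hLμ μ ⟨g, hgZ⟩
      have h3 : (⟨g, hgZ⟩ : Subgroup.center G) ≠ 1 := fun h3 ↦ hg (congrArg Subtype.val h3)
      have h4 : ∑ μ : Subgroup.center G →* ℂˣ, (μ ⟨g, hgZ⟩ : ℂ) = 0 :=
        sum_characters_apply_eq_zero (A := Subgroup.center G) h3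
      rw [h2, h4, zero_mul]
    · rw [sum_characters_apply_eq_zero hg', mul_zero]
  rw [hswap, Finset.sum_eq_single 1 (fun g _ hg ↦ by rw [hone g hg, mul_zero]) (by simp)] at hsum
  simp only [map_one, Units.val_one, (hL _).one, Finset.sum_const, Finset.card_univ,
    nsmul_eq_mul, mul_one] at hsum
  refine mul_right_cancel₀ (b := (Fintype.card (Subgroup.center G →* ℂˣ) : ℂ) *
    Fintype.card (Abelianization G →* ℂˣ)) ?_ (by rw [hsum, one_mul])
  exact mul_ne_zero (Nat.cast_ne_zero.2 Fintype.card_ne_zero)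
    (Nat.cast_ne_zero.2 Fintype.card_ne_zero)

end Eval

end CentralCharacters

/-! ### Groups all of whose central characters take values in an imaginary quadratic ring -/

section Sufficiency

/-- The third or fourth roots of unity span a lattice `ℤ + ℤζ` on which the squared absolute value
is integral. -/
theorem exists_normSq_eq_intCast_of_pow_eq_one {n : ℕ} (hn : n = 3 ∨ n = 4) {ι : Type*}
    [Fintype ι] (a : ι → ℤ) (f : ι → ℂ) (hf : ∀ i, f i ≠ 0 → f i ^ n = 1) :
    ∃ m : ℤ, Complex.normSq (∑ i, (a i : ℂ) * f i) = m := by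
  obtain ⟨ζ, c, hre, hnorm, hζ⟩ : ∃ (ζ : ℂ) (c : ℤ), 2 * ζ.re = c ∧ Complex.normSq ζ = 1 ∧
      ∀ z : ℂ, z ^ n = 1 → ∃ x y : ℤ, z = x + y * ζ := by
    rcases hn with rfl | rfl
    · have hs : √3 * √3 = 3 := Real.mul_self_sqrt (by norm_num)
      have hζ2 : (⟨-1 / 2, √3 / 2⟩ : ℂ) ^ 2 + ⟨-1 / 2, √3 / 2⟩ + 1 = 0 := by
        apply Complex.ext
        · simp [pow_two]
          linear_combination -hs / 4
        · simp [pow_two]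
          ring
      refine ⟨⟨-1 / 2, √3 / 2⟩, -1, by norm_num, ?_, fun z hz ↦ ?_⟩
      · rw [Complex.normSq_mk]
        linear_combination hs / 4
      · generalize (⟨-1 / 2, √3 / 2⟩ : ℂ) = ζ at hζ2
        have h : (z - 1) * ((z - ζ) * (z + 1 + ζ)) = 0 := by
          linear_combination hz + (1 - z) * hζ2
        rcases mul_eq_zero.1 h with h | h
        · exact ⟨1, 0, by push_cast; linear_combination h⟩
        · rcases mul_eq_zero.1 h with h | h
          · exact ⟨0, 1, by push_cast; linear_combination h⟩
          · exact ⟨-1, -1, by push_cast; linear_combination h⟩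
    · refine ⟨Complex.I, 0, by simp, Complex.normSq_I, fun z hz ↦ ?_⟩
      have h : ((z - 1) * (z + 1)) * ((z - Complex.I) * (z + Complex.I)) = 0 := by
        linear_combination hz + (1 - z ^ 2) * Complex.I_sq
      rcases mul_eq_zero.1 h with h | h <;> rcases mul_eq_zero.1 h with h | h
      · exact ⟨1, 0, by push_cast; linear_combination h⟩
      · exact ⟨-1, 0, by push_cast; linear_combination h⟩
      · exact ⟨0, 1, by push_cast; linear_combination h⟩
      · exact ⟨0, -1, by push_cast; linear_combination h⟩
  have hf' (i : ι) : ∃ x y : ℤ, f i = x + y * ζ := by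
    by_cases h : f i = 0
    · exact ⟨0, 0, by simp [h]⟩
    · exact hζ _ (hf i h)
  choose x y hxy using hf'
  have hsum : ∑ i, (a i : ℂ) * f i
      = ((∑ i, a i * x i : ℤ) : ℂ) + ((∑ i, a i * y i : ℤ) : ℂ) * ζ := by
    push_cast
    rw [Finset.sum_mul, ← Finset.sum_add_distrib]
    exact Finset.sum_congr rfl fun i _ ↦ by rw [hxy]; ring
  rw [hsum]
  generalize (∑ i, a i * x i) = s
  generalize (∑ i, a i * y i) = t
  refine ⟨s ^ 2 + s * t * c + t ^ 2, ?_⟩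
  rw [Complex.normSq_apply] at hnorm ⊢
  simp only [Complex.add_re, Complex.intCast_re, Complex.mul_re, Complex.intCast_im, zero_mul,
    sub_zero, Complex.add_im, Complex.mul_im, add_zero, zero_add]
  push_cast
  linear_combination (s * t : ℝ) * hre + (t ^ 2 : ℝ) * hnorm

theorem coeff_conj_eq_of_mem_center {G : Type*} [Group G] {u : (MonoidAlgebra ℤ G)ˣ}
    (hu : u ∈ Subgroup.center (MonoidAlgebra ℤ G)ˣ) (t g : G) :
    (u : MonoidAlgebra ℤ G).coeff (t * g * t⁻¹) = (u : MonoidAlgebra ℤ G).coeff g := by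
  have h := congrArg Units.val (Subgroup.mem_center_iff.1 hu
    (Units.map (MonoidAlgebra.of ℤ G) (toUnits t)))
  have h' := congrArg (fun z : MonoidAlgebra ℤ G ↦ z.coeff (t * g)) h
  simpa [MonoidAlgebra.of_apply, MonoidAlgebra.coeff_single_mul_apply,
    MonoidAlgebra.coeff_mul_single_apply] using h'.symm

variable {G : Type*} [Group G]

/-- If `g ^ n` is a commutator of `g` for all `g`, then central characters take values in the third
or fourth roots of unity, so they send a central unit to a unit of an imaginary quadratic ring,
which has absolute value one. -/
theorem IsCentralCharacter.normSq_groupRingEval_eq_one [Fintype G]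
    (hc : ∀ g t : G, ⁅g, t⁆ ∈ Subgroup.center G)
    {n : ℕ} (hn : n = 3 ∨ n = 4) (h : ∀ x : G, x ^ n ∈ commutatorsWith x)
    {L : G → ℂ} (hL : IsCentralCharacter L) {u : (MonoidAlgebra ℤ G)ˣ}
    (hu : u ∈ Subgroup.center (MonoidAlgebra ℤ G)ˣ) :
    Complex.normSq (groupRingEval L u) = 1 := by
  have hint (z : MonoidAlgebra ℤ G) : ∃ m : ℤ, Complex.normSq (groupRingEval L z) = m :=
    exists_normSq_eq_intCast_of_pow_eq_one hn z.coeff L fun g hg ↦ hL.pow_eq_one (h g) hg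
  have hmul : groupRingEval L u * groupRingEval L (u⁻¹ : (MonoidAlgebra ℤ G)ˣ) = 1 := by
    rw [← hL.groupRingEval_mul hc (coeff_conj_eq_of_mem_center hu), Units.mul_inv,
      groupRingEval_one, hL.one]
  obtain ⟨a, ha⟩ := hint u
  obtain ⟨b, hb⟩ := hint (u⁻¹ : (MonoidAlgebra ℤ G)ˣ)
  have hab : a * b = 1 := by
    have := congrArg Complex.normSq hmul
    rw [map_mul, ha, hb, map_one] at this
    exact_mod_cast this
  have ha0 : 0 ≤ a := by exact_mod_cast ha ▸ Complex.normSq_nonneg _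
  rw [ha, Int.eq_one_of_mul_eq_one_right ha0 hab, Int.cast_one]

/-- A central unit of absolute value one under every central character has coefficient vector of
length one, so it is trivial. -/
theorem hasCutProperty_of_forall_pow_mem_commutatorsWith [Finite G]
    (hc : ∀ g t : G, ⁅g, t⁆ ∈ Subgroup.center G)
    {n : ℕ} (hn : n = 3 ∨ n = 4) (h : ∀ x : G, x ^ n ∈ commutatorsWith x) :
    HasCutProperty G := by
  classical
  have := Fintype.ofFinite G
  intro u hu
  set c : G → ℤ := ⇑(u : MonoidAlgebra ℤ G).coeff with hcdef
  have hconj : ∀ t g, c (t * g * t⁻¹) = c g := coeff_conj_eq_of_mem_center hu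
  -- The sum of the squares of the coefficients is the coefficient of `1` in `u * star u`.
  have hsq : ∑ g, c g ^ 2 = 1 := by
    have key := apply_one_eq_of_forall_isCentralCharacter hc
      (fun k ↦ ∑ h, (c h : ℂ) * c (k * h)) fun L hL ↦ by
      have h1 := hL.normSq_groupRingEval_eq_one hc hn h hu
      have h2 : (starRingEnd ℂ) (groupRingEval L u) = ∑ h, (c h : ℂ) * L h⁻¹ := by
        simp [groupRingEval, hL.conj_apply, hcdef]
      calc ∑ k, (∑ h, (c h : ℂ) * c (k * h)) * L k
          = ∑ h, (c h : ℂ) * ∑ k, (c (k * h) : ℂ) * L k := by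
            simp only [Finset.sum_mul, Finset.mul_sum]
            rw [Finset.sum_comm]
            simp only [mul_assoc]
        _ = ∑ h, (c h : ℂ) * groupRingEval (fun g ↦ L (g * h⁻¹)) u := by
            refine Finset.sum_congr rfl fun h _ ↦ congrArg _ ?_
            rw [groupRingEval]
            conv_rhs => rw [← Equiv.sum_comp (Equiv.mulRight h)]
            simp [hcdef]
        _ = groupRingEval L u * (starRingEnd ℂ) (groupRingEval L u) := by
            rw [h2, Finset.mul_sum]
            refine Finset.sum_congr rfl fun h _ ↦ ?_
            rw [hL.groupRingEval_translate hc hconj]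
            ring
        _ = 1 := by rw [Complex.mul_conj, h1, Complex.ofReal_one]
    simp only [one_mul, ← pow_two] at key
    exact_mod_cast key
  obtain ⟨g, hg⟩ : ∃ g, c g ≠ 0 := by
    by_contra! h0
    simp [h0] at hsq
  have hsplit := Finset.add_sum_erase Finset.univ (fun g ↦ c g ^ 2) (Finset.mem_univ g)
  have hrest : ∀ k ∈ Finset.univ.erase g, 0 ≤ c k ^ 2 := fun k _ ↦ sq_nonneg _
  have hpos : 0 < c g ^ 2 := by positivity
  have hrest0 : ∑ k ∈ Finset.univ.erase g, c k ^ 2 = 0 :=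
    le_antisymm (by linarith) (Finset.sum_nonneg hrest)
  have hzero (k : G) (hk : k ≠ g) : c k = 0 :=
    pow_eq_zero_iff two_ne_zero |>.1 <| (Finset.sum_eq_zero_iff_of_nonneg hrest).1 hrest0 k <|
      Finset.mem_erase.2 ⟨hk, Finset.mem_univ k⟩
  have hcg : c g = 1 ∨ c g = -1 := sq_eq_one_iff.1 <| by
    simp only [hrest0, hsq, add_zero] at hsplit
    exact hsplit
  have hu' : (u : MonoidAlgebra ℤ G) = MonoidAlgebra.single g (c g) := by
    ext k
    by_cases hk : k = g
    · simp [hk, hcdef]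
    · rw [MonoidAlgebra.coeff_single, Finsupp.single_eq_of_ne hk]
      exact hzero k hk
  refine ⟨g, Subgroup.mem_center_iff.2 fun t ↦ ?_, ?_⟩
  · by_contra ht
    refine hg ?_
    rw [← hconj t g]
    exact hzero _ fun h' ↦ ht (mul_inv_eq_iff_eq_mul.1 h')
  · refine hcg.imp (fun h' ↦ ?_) fun h' ↦ ?_
    · rw [hu', h', MonoidAlgebra.of_apply]
    · rw [hu', h', MonoidAlgebra.of_apply, ← MonoidAlgebra.single_neg]

end Sufficiency

/-! ### Bass units -/

section Bass

variable {R : Type*} [CommRing R]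

/-- The Bass element `(1 + X + ⋯ + X ^ (k - 1)) ^ φ(n) + c (1 + X + ⋯ + X ^ (n - 1))` with the
integer `c = (1 - k ^ φ(n)) / n`; the division is exact when `k` is coprime to `n`. -/
def bassElement (n k : ℕ) (X : R) : R :=
  (∑ i ∈ Finset.range k, X ^ i) ^ n.totient +
    (((1 - (k : ℤ) ^ n.totient) / n : ℤ) : R) * ∑ i ∈ Finset.range n, X ^ i

theorem map_bassElement {S : Type*} [CommRing S] (f : R →+* S) (n k : ℕ) (X : R) :
    f (bassElement n k X) = bassElement n k (f X) := by
  simp [bassElement]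

theorem geom_sum_mul_range (X : R) (k b : ℕ) :
    (∑ i ∈ Finset.range k, X ^ i) * ∑ i ∈ Finset.range b, (X ^ k) ^ i =
      ∑ i ∈ Finset.range (k * b), X ^ i := by
  induction b with
  | zero => simp
  | succ b ih =>
    rw [Finset.sum_range_succ, mul_add, ih, Nat.mul_succ, Finset.sum_range_add,
      Finset.sum_mul]
    simp only [pow_add, pow_mul, mul_comm]

theorem mul_geom_sum_of_pow_eq_one {X : R} {n : ℕ} (hX : X ^ n = 1) :
    X * ∑ i ∈ Finset.range n, X ^ i = ∑ i ∈ Finset.range n, X ^ i := by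
  have := mul_geom_sum X n
  rw [hX, sub_self] at this
  linear_combination this

theorem geom_sum_mul_geom_sum_of_pow_eq_one {X Y : R} {n : ℕ}
    (hY : Y * ∑ i ∈ Finset.range n, X ^ i = ∑ i ∈ Finset.range n, X ^ i) (k : ℕ) :
    (∑ i ∈ Finset.range k, Y ^ i) * ∑ i ∈ Finset.range n, X ^ i =
      k * ∑ i ∈ Finset.range n, X ^ i := by
  have h (i : ℕ) : Y ^ i * ∑ i ∈ Finset.range n, X ^ i = ∑ i ∈ Finset.range n, X ^ i := by
    induction i with
    | zero => simp
    | succ i ih => rw [pow_succ, mul_assoc, hY, ih]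
  rw [Finset.sum_mul, Finset.sum_congr rfl fun i _ ↦ h i]
  simp

theorem natCast_dvd_one_sub_pow_totient {n k : ℕ} (hk : k.Coprime n) :
    (n : ℤ) ∣ 1 - (k : ℤ) ^ n.totient := by
  have := (Nat.modEq_iff_dvd (n := n)).1 (Nat.ModEq.pow_totient hk)
  exact_mod_cast this

/-- A Bass element at an element of order dividing `n` is a unit: its inverse is the Bass element at
`X ^ k` for an inverse of `k` modulo `n`, up to a multiple of the sum of the powers of `X` which
vanishes because both elements have augmentation one. -/
theorem isUnit_bassElement {n k : ℕ} (hn : 0 < n) (hk0 : 0 < k) (hk : k.Coprime n) {X : R} (hX : X ^ n = 1) :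
    IsUnit (bassElement n k X) := by
  obtain ⟨c, hc⟩ := natCast_dvd_one_sub_pow_totient hk
  set b : ℕ := k ^ (n.totient - 1) with hb
  obtain ⟨c', hc'⟩ := natCast_dvd_one_sub_pow_totient (hk.pow_left (n.totient - 1))
  rw [← hb] at hc'
  have hkb : k * b = k ^ n.totient := by
    rw [hb, ← pow_succ', Nat.sub_add_cancel (Nat.totient_pos.2 hn)]
  have hn' : (n : ℤ) ≠ 0 := by exact_mod_cast hn.ne'
  set N : R := ∑ i ∈ Finset.range n, X ^ i with hN
  have hXN : X * N = N := mul_geom_sum_of_pow_eq_one hX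
  have hXkN : X ^ k * N = N := by
    clear * - hXN
    induction k with
    | zero => simp
    | succ k ih => rw [pow_succ, mul_assoc, hXN, ih]
  have hNN : N * N = n * N := geom_sum_mul_geom_sum_of_pow_eq_one hXN n
  have hpow (a Y : R) (h : Y * N = a * N) (m : ℕ) : Y ^ m * N = a ^ m * N := by
    induction m with
    | zero => simp
    | succ m ih => rw [pow_succ, mul_assoc, h, mul_left_comm, ih, pow_succ]; ring
  have h1 := hpow _ _ (geom_sum_mul_geom_sum_of_pow_eq_one hXN k) n.totient
  have h2 := hpow _ _ (geom_sum_mul_geom_sum_of_pow_eq_one hXkN b) n.totient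
  -- The product of the two geometric sums is `1 + l N`.
  have hl : ∃ l : ℤ, (k : ℤ) * b = 1 + l * n ∧
      (∑ i ∈ Finset.range k, X ^ i) * ∑ i ∈ Finset.range b, (X ^ k) ^ i = 1 + l * N := by
    have hpos : 1 ≤ k * b := hkb ▸ Nat.one_le_pow _ _ hk0
    obtain ⟨l, hl⟩ := (Nat.modEq_iff_dvd' hpos).1 (hkb ▸ (Nat.ModEq.pow_totient hk).symm)
    have hl' : k * b = n * l + 1 := by omega
    refine ⟨l, by exact_mod_cast (by rw [hl']; ring : k * b = 1 + l * n), ?_⟩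
    rw [geom_sum_mul_range, hl', Finset.sum_range_succ, ← geom_sum_mul_range, pow_mul, hX, ← hN]
    simp
    ring
  obtain ⟨l, hl, hprod⟩ := hl
  have ht (m : ℕ) : ∃ t : ℤ, ((k : ℤ) * b) ^ m = 1 + t * n ∧ (1 + l * N) ^ m = 1 + t * N := by
    induction m with
    | zero => exact ⟨0, by simp, by simp⟩
    | succ m ih =>
      obtain ⟨t, h3, h4⟩ := ih
      refine ⟨t + l + t * l * n, by rw [pow_succ, h3, hl]; ring, ?_⟩
      rw [pow_succ, h4]
      push_cast
      linear_combination (t * l : R) * hNN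
  obtain ⟨t, ht1, ht2⟩ := ht n.totient
  have hzero : t + c' * (k : ℤ) ^ n.totient + c * (b : ℤ) ^ n.totient + c * c' * n = 0 := by
    rw [mul_pow] at ht1
    refine mul_left_cancel₀ hn' ?_
    linear_combination -ht1 - hc - ((k : ℤ) ^ n.totient + n * c) * hc'
  have hzero' := congrArg (Int.cast : ℤ → R) hzero
  push_cast at hzero'
  refine IsUnit.of_mul_eq_one ((∑ i ∈ Finset.range b, (X ^ k) ^ i) ^ n.totient + c' * N) ?_
  rw [bassElement, hc, Int.mul_ediv_cancel_left _ hn', ← hN]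
  rw [← hprod, mul_pow] at ht2
  linear_combination ht2 + c' * h1 + c * h2 + c * c' * hNN + N * hzero'

theorem bassElement_mul_pow {n k : ℕ} {ζ : ℂ} (hζ : ζ ^ n = 1) (hζ1 : ζ ≠ 1) :
    bassElement n k ζ * (ζ - 1) ^ n.totient = (ζ ^ k - 1) ^ n.totient := by
  have h0 : ∑ i ∈ Finset.range n, ζ ^ i = 0 := by
    have := geom_sum_mul ζ n
    rw [hζ, sub_self] at this
    exact (mul_eq_zero.1 this).resolve_right (sub_ne_zero.2 hζ1)
  rw [bassElement, h0, mul_zero, add_zero, ← mul_pow, geom_sum_mul]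

/-- The distance from `1` determines a point of the unit circle up to complex conjugation. -/
theorem eq_or_mul_eq_one_of_norm_sub_one_eq {z w : ℂ} (hz : ‖z‖ = 1) (hw : ‖w‖ = 1)
    (h : ‖w - 1‖ = ‖z - 1‖) : w = z ∨ w * z = 1 := by
  have hz' : z * (starRingEnd ℂ) z = 1 := by
    rw [Complex.mul_conj, Complex.normSq_eq_norm_sq, hz]
    simp
  have hw' : w * (starRingEnd ℂ) w = 1 := by
    rw [Complex.mul_conj, Complex.normSq_eq_norm_sq, hw]
    simp
  have h' : (w - 1) * (starRingEnd ℂ) (w - 1) = (z - 1) * (starRingEnd ℂ) (z - 1) := by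
    rw [Complex.mul_conj, Complex.mul_conj, Complex.normSq_eq_norm_sq, Complex.normSq_eq_norm_sq, h]
  simp only [map_sub, map_one] at h'
  have hmul : (w - z) * (w * z - 1) = 0 := by
    linear_combination w * z * (hw' - hz' - h') - z * hw' + w * hz'
  exact (mul_eq_zero.1 hmul).imp sub_eq_zero.1 sub_eq_zero.1

theorem norm_bassElement_ne_one {n k : ℕ} (hn : 0 < n) {ζ : ℂ} (hζ : ζ ^ n = 1)
    (h1 : ζ ^ k ≠ ζ) (h2 : ζ ^ (k + 1) ≠ 1) : ‖bassElement n k ζ‖ ≠ 1 := by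
  intro h
  have hnorm : ‖ζ‖ = 1 := Complex.norm_eq_one_of_pow_eq_one hζ hn.ne'
  have hζ1 : ζ ≠ 1 := by
    rintro rfl
    simp at h1
  have h3 := congrArg norm (bassElement_mul_pow (k := k) hζ hζ1)
  rw [norm_mul, h, one_mul, norm_pow, norm_pow] at h3
  have h4 := (pow_left_inj₀ (norm_nonneg _) (norm_nonneg _) (Nat.totient_pos.2 hn).ne').1 h3
  rcases eq_or_mul_eq_one_of_norm_sub_one_eq hnorm (by rw [norm_pow, hnorm, one_pow]) h4.symm
    with h5 | h5
  · exact h1 h5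
  · exact h2 (by rw [pow_succ, h5])

end Bass

/-! ### Central units from products of conjugate Bass units -/

section Necessity

variable {G : Type*} [Group G] [Finite G]

omit [Finite G] in
theorem mem_center_units_of_forall_of_mul {u : (MonoidAlgebra ℤ G)ˣ}
    (h : ∀ g : G, MonoidAlgebra.of ℤ G g * u = u * MonoidAlgebra.of ℤ G g) :
    u ∈ Subgroup.center (MonoidAlgebra ℤ G)ˣ := by
  refine Subgroup.mem_center_iff.2 fun v ↦ Units.ext ?_
  rw [Units.val_mul, Units.val_mul]
  generalize (v : MonoidAlgebra ℤ G) = z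
  induction z using MonoidAlgebra.induction_linear with
  | zero => simp
  | add z w hz hw => rw [add_mul, mul_add, hz, hw]
  | single g a =>
    have hs : MonoidAlgebra.single g a = a • MonoidAlgebra.of ℤ G g := by
      simp [MonoidAlgebra.of_apply]
    rw [hs, smul_mul_assoc, mul_smul_comm, h]

/-- Let `a` be an element of an abelian normal subgroup `A`, and `χ` a linear character of `A` which
takes the same value at all conjugates of `a`. The product of the Bass units at the conjugates of
`a` is central, and `χ` maps it to a power of the Bass element at `χ a`, which is not of absolute
value one when `χ a ^ k` is neither `χ a` nor its inverse. -/
theorem HasCutProperty.pow_eq_or_pow_succ_eq_one (hG : HasCutProperty G) {A : Type*} [CommGroup A]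
    (ι : A →* G) (hι : Function.Injective ι) (σ : G → A →* A)
    (hσ : ∀ g a, ι (σ g a) = g * ι a * g⁻¹) {k : ℕ} (hk0 : 0 < k) (hk : k.Coprime (Nat.card G))
    (χ : A →* ℂˣ) (a : A) (hχ : ∀ g, χ (σ g a) = χ a) :
    χ a ^ k = χ a ∨ χ a ^ (k + 1) = 1 := by
  have := Fintype.ofFinite G
  by_contra! hne
  set n := Nat.card G
  have hn : 0 < n := Nat.card_pos
  have hpow (b : A) : b ^ n = 1 := hι (by rw [map_pow, pow_card_eq_one', map_one])
  set v : MonoidAlgebra ℤ A := ∏ g, bassElement n k (MonoidAlgebra.of ℤ A (σ g a)) with hv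
  have hvu : IsUnit v := by
    refine IsUnit.prod_univ_iff.2 fun g ↦ isUnit_bassElement hn hk0 hk ?_
    rw [← map_pow, hpow, map_one]
  have hσσ (g h : G) : σ h (σ g a) = σ (h * g) a := hι (by simp only [hσ]; group)
  have hvσ (h : G) : MonoidAlgebra.mapDomainRingHom ℤ (σ h) v = v := by
    rw [hv, map_prod]
    simp only [map_bassElement]
    rw [← Equiv.prod_comp (Equiv.mulLeft h)
      (fun g ↦ bassElement n k (MonoidAlgebra.of ℤ A (σ g a)))]
    simp [hσσ]
  set Φ : MonoidAlgebra ℤ A →+* MonoidAlgebra ℤ G := MonoidAlgebra.mapDomainRingHom ℤ ι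
  have hΦσ (h : G) (z : MonoidAlgebra ℤ A) : MonoidAlgebra.of ℤ G h * Φ z =
      Φ (MonoidAlgebra.mapDomainRingHom ℤ (σ h) z) * MonoidAlgebra.of ℤ G h := by
    induction z using MonoidAlgebra.induction_linear with
    | zero => simp
    | add z w hz hw => rw [map_add, mul_add, hz, hw, map_add, map_add, add_mul]
    | single b c => simp [Φ, MonoidAlgebra.of_apply, MonoidAlgebra.single_mul_single, hσ]
  obtain ⟨u, hu⟩ := hvu.map Φ
  obtain ⟨g, -, hg⟩ := hG u <| mem_center_units_of_forall_of_mul fun h ↦ by rw [hu, hΦσ, hvσ]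
  have hg1 : MonoidAlgebra.of ℤ G g ^ n = 1 := by rw [← map_pow, pow_card_eq_one', map_one]
  -- A trivial unit has finite order, and this is inherited by `v` as `Φ` is injective.
  have hv1 : v ^ (n * 2) = 1 := by
    refine MonoidAlgebra.mapDomain_injective (R := ℤ) hι ?_
    change Φ (v ^ (n * 2)) = Φ 1
    rw [map_pow, map_one, ← hu, pow_mul]
    rcases hg with hg | hg
    · rw [hg, hg1, one_pow]
    · rw [hg, neg_pow, hg1, mul_one, ← pow_mul, mul_comm, pow_mul, neg_one_sq, one_pow]
  set Ψ : MonoidAlgebra ℤ A →+* ℂ :=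
    (MonoidAlgebra.lift ℤ ℂ A ((Units.coeHom ℂ).comp χ)).toRingHom
  have hΨ (b : A) : Ψ (MonoidAlgebra.of ℤ A b) = χ b := by simp [Ψ]
  have h1 : bassElement n k (χ a : ℂ) ^ (n * (n * 2)) = 1 := by
    have := congrArg Ψ hv1
    rw [map_pow, map_one, hv, map_prod] at this
    simp only [map_bassElement, hΨ, hχ, Finset.prod_const, Finset.card_univ] at this
    rwa [← Nat.card_eq_fintype_card, ← pow_mul] at this
  refine norm_bassElement_ne_one (k := k) hn ?_ ?_ ?_
    (Complex.norm_eq_one_of_pow_eq_one h1 (by positivity))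
  · rw [← Units.val_pow_eq_pow_val, ← map_pow, hpow, map_one, Units.val_one]
  · exact fun h ↦ hne.1 (Units.ext (by simpa using h))
  · exact fun h ↦ hne.2 (Units.ext (by simpa using h))

open scoped IsMulCommutative in
/-- The power `x ^ m` lies in `[x, G]` because no character of the subgroup generated by `x` and the
centre which is trivial on `[x, G]` detects it. -/
theorem HasCutProperty.pow_mem_commutatorsWith (hG : HasCutProperty G)
    (hc : ∀ g t : G, ⁅g, t⁆ ∈ Subgroup.center G) {k m : ℕ} (hk0 : 0 < k)
    (hk : k.Coprime (Nat.card G)) (hm : ∀ z : ℂˣ, z ^ k = z ∨ z ^ (k + 1) = 1 → z ^ m = 1)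
    (x : G) : x ^ m ∈ commutatorsWith x := by
  obtain ⟨C, hC⟩ := exists_subgroup_coe_eq_commutatorsWith hc x
  rw [← hC, SetLike.mem_coe]
  by_contra hxC
  let A : Subgroup G := Subgroup.closure (insert x (Subgroup.center G))
  have hZA : (Subgroup.center G : Set G) ⊆ A := (Set.subset_insert _ _).trans Subgroup.subset_closure
  have hxA : x ∈ A := Subgroup.subset_closure (Set.mem_insert _ _)
  have hA : IsMulCommutative A := Subgroup.isMulCommutative_closure <| by
    rintro a (rfl | ha) b (rfl | hb)
    · rfl
    · exact Subgroup.mem_center_iff.1 hb _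
    · exact (Subgroup.mem_center_iff.1 ha _).symm
    · exact Subgroup.mem_center_iff.1 hb _
  have hAn : A.Normal := ⟨fun a ha g ↦ by
    have h1 := mul_mem (hZA (hc g a)) ha
    rwa [commutatorElement_def, inv_mul_cancel_right] at h1⟩
  obtain ⟨χ, hχC, hχ⟩ := exists_character_apply_ne_one (C.subgroupOf A) (y := (⟨x, hxA⟩ : A) ^ m)
    (fun h ↦ hxC (by simpa [Subgroup.mem_subgroupOf] using h))
  rw [map_pow] at hχ
  refine hχ (hm _ (hG.pow_eq_or_pow_succ_eq_one A.subtype A.subtype_injective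
    (fun g ↦ (MulAut.conjNormal g : A ≃* A).toMonoidHom) (fun g a ↦ ?_) hk0 hk χ ⟨x, hxA⟩
    fun g ↦ ?_))
  · simp
  · have h1 : (MulAut.conjNormal g : A ≃* A) ⟨x, hxA⟩ * ⟨x, hxA⟩⁻¹ ∈ C.subgroupOf A := by
      rw [Subgroup.mem_subgroupOf, ← inv_mem_iff, ← SetLike.mem_coe, hC]
      refine ⟨g, ?_⟩
      simp [mul_assoc]
    have h2 := hχC _ h1
    rw [map_mul, map_inv, mul_inv_eq_one] at h2
    exact h2

end Necessity

/-! ### The criterion for `p`-groups -/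

theorem IsPGroup.commutatorElement_mem_center {p : ℕ} [Fact p.Prime] {G : Type*} [Group G]
    [Finite G] (hp : IsPGroup p G) (h : Group.nilpotencyClass G ≤ 2) (g t : G) :
    ⁅g, t⁆ ∈ Subgroup.center G :=
  have := hp.isNilpotent
  commutatorElement_mem_center_of_nilpotencyClass_le_two h g t

theorem IsPGroup.pow_mem_commutatorsWith_of_hasCutProperty {p : ℕ} [hp : Fact p.Prime]
    {G : Type*} [Group G] [Finite G] [Nontrivial G] (hG : IsPGroup p G)
    (hc : ∀ g t : G, ⁅g, t⁆ ∈ Subgroup.center G) (hcut : HasCutProperty G) :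
    (p = 2 ∧ ∀ x : G, x ^ 4 ∈ commutatorsWith x) ∨
      (p = 3 ∧ ∀ x : G, x ^ 3 ∈ commutatorsWith x) := by
  obtain ⟨e, he⟩ := IsPGroup.iff_card.1 hG
  have hcop {k : ℕ} (hk : k.Coprime p) : k.Coprime (Nat.card G) := he ▸ hk.pow_right e
  rcases eq_or_ne p 2 with rfl | h2
  · refine .inl ⟨rfl, hcut.pow_mem_commutatorsWith hc (k := 3) (by norm_num)
      (hcop (by norm_num)) fun z hz ↦ hz.elim (fun h ↦ ?_) id⟩
    have h1 : z ^ 2 = 1 := mul_right_cancel (b := z) (by rw [← pow_succ, h, one_mul])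
    rw [show 4 = 2 * 2 from rfl, pow_mul, h1, one_pow]
  · have hcube : ∀ x : G, x ^ 3 ∈ commutatorsWith x :=
      hcut.pow_mem_commutatorsWith hc (k := 2) (by norm_num)
        (hcop ((Nat.coprime_primes Nat.prime_two hp.out).2 h2.symm)) fun z hz ↦
          hz.elim (fun h ↦ by rw [pow_two, mul_eq_left] at h; rw [h, one_pow]) id
    refine .inr ⟨?_, hcube⟩
    -- A nontrivial central element has order three.
    have := hG.center_nontrivial
    obtain ⟨z, hz⟩ := exists_ne (1 : Subgroup.center G)
    obtain ⟨g, hg⟩ := hcube z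
    have h3 : (z : G) ^ 3 = 1 := by
      rw [hg, ← Subgroup.mem_center_iff.1 z.2 g, mul_inv_cancel_right, mul_inv_cancel]
    have hord : orderOf (z : G) = 3 :=
      orderOf_eq_prime h3 fun h ↦ hz (Subtype.ext h)
    have hdvd : 3 ∣ p ^ e := he ▸ hord ▸ orderOf_dvd_natCard (z : G)
    exact ((Nat.prime_dvd_prime_iff_eq Nat.prime_three hp.out).1
      (Nat.prime_three.dvd_of_dvd_pow hdvd)).symm

theorem pow_mem_commutatorsWith_prod {H K : Type*} [Group H] [Group K] {n : ℕ}
    (hH : ∀ x : H, x ^ n ∈ commutatorsWith x) (hK : ∀ x : K, x ^ n ∈ commutatorsWith x)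
    (x : H × K) : x ^ n ∈ commutatorsWith x := by
  obtain ⟨g, hg⟩ := hH x.1
  obtain ⟨t, ht⟩ := hK x.2
  exact ⟨(g, t), Prod.ext hg ht⟩

/-- The trivial group satisfies the condition for every `n`; for a nontrivial group `n` is `4` if `p = 2` and `3` if `p = 3`. -/
theorem IsPGroup.pow_mem_commutatorsWith_of_hasCutProperty_of_eq {p : ℕ} [Fact p.Prime]
    {G : Type*} [Group G] [Finite G] (hG : IsPGroup p G)
    (hc : ∀ g t : G, ⁅g, t⁆ ∈ Subgroup.center G) (hcut : HasCutProperty G) {n : ℕ}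
    (hn : p = 2 → n = 4) (hn' : p = 3 → n = 3) (x : G) : x ^ n ∈ commutatorsWith x := by
  cases subsingleton_or_nontrivial G
  · exact ⟨1, Subsingleton.elim _ _⟩
  · rcases hG.pow_mem_commutatorsWith_of_hasCutProperty hc hcut with ⟨hp, h⟩ | ⟨hp, h⟩
    · exact hn hp ▸ h x
    · exact hn' hp ▸ h x

theorem mainTheorem4 (p : ℕ) [Fact p.Prime] :
    (∀ (G : Type*) [Group G] [Finite G] [Nontrivial G],
      IsPGroup p G → Group.nilpotencyClass G ≤ 2 →
        (HasCutProperty G ↔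
          (p = 2 ∧ ∀ x : G, x ^ 4 ∈ commutatorsWith x) ∨
          (p = 3 ∧ ∀ x : G, x ^ 3 ∈ commutatorsWith x))) ∧
    (∀ (H : Type*) (K : Type*) [Group H] [Finite H] [Group K] [Finite K],
      IsPGroup p H → Group.nilpotencyClass H ≤ 2 →
      IsPGroup p K → Group.nilpotencyClass K ≤ 2 →
        HasCutProperty H → HasCutProperty K → HasCutProperty (H × K)) := by
  refine ⟨fun G _ _ _ hG hcl ↦ ?_, fun H K _ _ _ _ hH hclH hK hclK hcutH hcutK ↦ ?_⟩
  · have hc := hG.commutatorElement_mem_center hcl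
    refine ⟨hG.pow_mem_commutatorsWith_of_hasCutProperty hc, ?_⟩
    rintro (⟨-, h⟩ | ⟨-, h⟩)
    · exact hasCutProperty_of_forall_pow_mem_commutatorsWith hc (.inr rfl) h
    · exact hasCutProperty_of_forall_pow_mem_commutatorsWith hc (.inl rfl) h
  · have hcH := hH.commutatorElement_mem_center hclH
    have hcK := hK.commutatorElement_mem_center hclK
    have hc (g t : H × K) : ⁅g, t⁆ ∈ Subgroup.center (H × K) :=
      Subgroup.mem_center_iff.2 fun k ↦ Prod.ext
        (Subgroup.mem_center_iff.1 (hcH g.1 t.1) k.1) (Subgroup.mem_center_iff.1 (hcK g.2 t.2) k.2)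
    obtain ⟨n, hn, hn2, hn3⟩ : ∃ n, (n = 3 ∨ n = 4) ∧ (p = 2 → n = 4) ∧ (p = 3 → n = 3) := by
      by_cases hp : p = 2
      · exact ⟨4, .inr rfl, fun _ ↦ rfl, by omega⟩
      · exact ⟨3, .inl rfl, by omega, fun _ ↦ rfl⟩
    exact hasCutProperty_of_forall_pow_mem_commutatorsWith hc hn <| pow_mem_commutatorsWith_prod
      (hH.pow_mem_commutatorsWith_of_hasCutProperty_of_eq hcH hcutH hn2 hn3)
      (hK.pow_mem_commutatorsWith_of_hasCutProperty_of_eq hcK hcutK hn2 hn3)
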